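/- Let $0<\bar q<\infty$ and let $U:(0,\bar q]\to\mathbb{R}$ be a (single-product) utility function, i.e. $U$ is differentiable (one-sidedly at $\bar q$) and the inverse demand $P=U'$ is non-increasing. Let $CS(q)=-qP(q)+\int_0^q P(q_1)\,dq_1$ denote the associated consumer surplus. Say that $U$ satisfies the complete monotonicity criterion if $x\mapsto CS(e^{-x})$ is completely monotone on $[-\log\bar q,\infty)$, that is, continuous there and, for $x>-\log\bar q$, infinitely differentiable with $(-1)^n\frac{d^n}{dx^n}CS(e^{-x})\ge 0$ for all $n=0,1,2,\dots$ Then the following are equivalent: (i) $U$ is bounded below on $(0,\bar q]$ and satisfies the complete monotonicity criterion; (ii) the Laplace consumer surplus is nonnegative and supported on $(-\infty,0)$, i.e. there is a nonnegative Borel measure $cs(t)\,dt$ on $(-\infty,0)$ (possibly with point masses, not necessarily having a density) such that, for all $q\in(0,\bar q]$, consumer surplus is finite, the integral below converges, and $$CS(q)=\int_{-\infty}^0 cs(t)\,q^{-t}\,dt .$$ -/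

import Mathlib

open Set MeasureTheory
open scoped ContDiff

noncomputable section

/-- The inverse demand curve `P = U'` of a utility function `U` on `(0, qbar]`
(at the right endpoint this is the one-sided derivative). -/
def inverseDemand (U : ℝ → ℝ) (qbar q : ℝ) : ℝ :=
  derivWithin U (Ioc 0 qbar) q

/-- A (single-product) utility function on `(0, qbar]`: a primitive of a non-increasing
inverse demand curve. It may be unbounded below as `q → 0`. -/
structure IsUtility (U : ℝ → ℝ) (qbar : ℝ) : Prop where
  differentiableOn : DifferentiableOn ℝ U (Ioc 0 qbar)
  antitoneOn : AntitoneOn (inverseDemand U qbar) (Ioc 0 qbar)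

/-- Consumer surplus `CS(q) = -q P(q) + ∫₀^q P`, a meaningful number when the integral converges.
(When it diverges, `P` tends to `+∞` at `0`, the expression below is `-q P(q)`, and this is negative
for small `q`; so it is then neither completely monotone nor a nonnegative integral.) -/
def consumerSurplus (U : ℝ → ℝ) (qbar q : ℝ) : ℝ :=
  -(q * inverseDemand U qbar q) + ∫ x in (0 : ℝ)..q, inverseDemand U qbar x

/-- The integral that defines consumer surplus converges. -/
def FiniteConsumerSurplus (U : ℝ → ℝ) (qbar : ℝ) : Prop :=
  IntervalIntegrable (inverseDemand U qbar) volume 0 qbar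

/-- `f` is completely monotone on the interval `I`: it is continuous on `I`, and inside `I` it has
derivatives of all orders `n = 0, 1, 2, …`, with `(-1)ⁿ f⁽ⁿ⁾ ≥ 0`. -/
structure CompletelyMonotoneOn (f : ℝ → ℝ) (I : Set ℝ) : Prop where
  continuousOn : ContinuousOn f I
  contDiffOn : ContDiffOn ℝ ∞ f (interior I)
  nonneg : ∀ n : ℕ, ∀ x ∈ interior I, 0 ≤ (-1) ^ n * iteratedDeriv n f x

/-- The complete monotonicity criterion: consumer surplus is a completely monotone function of
`x = -log q`, for `q ∈ (0, qbar]`. -/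
def CompleteMonotonicityCriterion (U : ℝ → ℝ) (qbar : ℝ) : Prop :=
  CompletelyMonotoneOn (fun x => consumerSurplus U qbar (Real.exp (-x))) (Ici (-Real.log qbar))

/-- The nonnegative measure `cs` (written `cs(t) dt`; it may have point masses) is supported on
`(-∞, 0)` and is the Laplace consumer surplus of `U`: consumer surplus is finite and
`CS(q) = ∫_{-∞}^0 q^{-t} cs(t) dt`, a convergent integral, for every `q ∈ (0, qbar]`. -/
structure IsNonnegLaplaceConsumerSurplus (U : ℝ → ℝ) (qbar : ℝ) (cs : Measure ℝ) : Prop where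
  finite : FiniteConsumerSurplus U qbar
  support : cs (Ici 0) = 0
  integrableOn : ∀ q ∈ Ioc 0 qbar, IntegrableOn (fun t : ℝ => q ^ (-t)) (Iio 0) cs
  eq_integral : ∀ q ∈ Ioc 0 qbar, consumerSurplus U qbar q = ∫ t in Iio 0, q ^ (-t) ∂cs

end

/-! With `q = e^{-x}`, `q^{-t} = e^{xt}`, so (ii) represents `CS(e^{-x})` as the Laplace transform
of a measure on `(-∞, 0)`; the core is Bernstein's theorem (`exists_measure_eq_integral_exp`). It is
reduced to Hausdorff's moment theorem (`exists_measure_moment_eq`): samples of a completely monotone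
function on a grid form a completely monotone sequence, and measures for finer dyadic grids have a
limit by compactness.

Two economic facts complete the equivalence. As `P ≥ P(qbar)` and `∫_q^qbar P = U(qbar) - U(q)`, `U`
is bounded below exactly when consumer surplus is finite. And `CS(q) ≤ -q P(qbar) + ∫_0^q P`, which
tends to `0` with `q`, so the measure has no atom at `t = 0`. The converse differentiates under the
integral sign. -/

open Filter Topology

/-! ### The Hausdorff moment problem -/

section UnitInterval

open unitInterval

/-- Finite measures of fixed total mass on a compact space have a limit along any ultrafilter. -/
theorem exists_finiteMeasure_tendsto_ultrafilter {E : Type*} [MeasurableSpace E]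
    [TopologicalSpace E] [T2Space E] [BorelSpace E] [CompactSpace E] {ι : Type*}
    (F : Ultrafilter ι) {C : ℝ} (ν : ι → Measure E) [∀ i, IsFiniteMeasure (ν i)]
    (hν : ∀ i, (ν i).real univ = C) :
    ∃ μ : Measure E, IsFiniteMeasure μ ∧
      ∀ g : C(E, ℝ), Tendsto (fun i => ∫ x, g x ∂ν i) F (𝓝 (∫ x, g x ∂μ)) := by
  let N : ι → FiniteMeasure E := fun i => ⟨ν i, inferInstance⟩
  have hmass : ∀ i, (N i).mass = C.toNNReal := by
    intro i
    rw [← hν i]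
    simp [N, FiniteMeasure.mass, Measure.real, ENNReal.toNNReal]
  obtain ⟨μ, -, hμ⟩ := isCompact_iff_ultrafilter_le_nhds'.1
    (isCompact_setOfPred_finiteMeasure_eq_of_compactSpace E C.toNNReal) (F.map N)
    (Filter.Eventually.of_forall (f := (F : Filter ι)) hmass)
  refine ⟨μ, inferInstance, fun g => ?_⟩
  have := FiniteMeasure.tendsto_iff_forall_integral_tendsto.1 (show Tendsto N F (𝓝 μ) from hμ)
    (BoundedContinuousFunction.mkOfCompact g)
  simpa [N] using this

/-- The forward difference with the sign `f n - f (n + 1)`. -/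
def negDiff (a : ℕ → ℝ) (n : ℕ) : ℝ := a n - a (n + 1)

/-- The linear functional on polynomials whose moments are `a`. -/
noncomputable def momentFunctional (a : ℕ → ℝ) : Polynomial ℝ →ₗ[ℝ] ℝ :=
  Polynomial.lsum fun n => a n • LinearMap.id

theorem momentFunctional_X_pow (a : ℕ → ℝ) (n : ℕ) :
    momentFunctional a (Polynomial.X ^ n) = a n := by
  simp [momentFunctional, Polynomial.lsum_apply, Polynomial.X_pow_eq_monomial,
    Polynomial.sum_monomial_index]

theorem momentFunctional_one_sub_X_mul (a : ℕ → ℝ) (p : Polynomial ℝ) :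
    momentFunctional a ((1 - Polynomial.X) * p) = momentFunctional (negDiff a) p := by
  induction p using Polynomial.induction_on' with
  | add p q hp hq => simp [mul_add, hp, hq]
  | monomial n c =>
    rw [← Polynomial.C_mul_X_pow_eq_monomial]
    have : (1 - Polynomial.X) * (Polynomial.C c * Polynomial.X ^ n) =
      c • (Polynomial.X ^ n - Polynomial.X ^ (n + 1) : Polynomial ℝ) := by
      rw [Polynomial.smul_eq_C_mul]; ring
    rw [this, ← Polynomial.smul_eq_C_mul]
    simp [momentFunctional_X_pow, negDiff]

theorem momentFunctional_X_pow_mul (a : ℕ → ℝ) (j n : ℕ) :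
    momentFunctional a (Polynomial.X ^ j * (1 - Polynomial.X) ^ n) = negDiff^[n] a j := by
  induction n generalizing a with
  | zero => simp [momentFunctional_X_pow]
  | succ n ih =>
    rw [pow_succ', mul_left_comm, momentFunctional_one_sub_X_mul, ih, Function.iterate_succ_apply]

/-- The Bernstein weights of a moment sequence. -/
noncomputable def bernsteinWeight (a : ℕ → ℝ) (n j : ℕ) : ℝ := n.choose j * negDiff^[n - j] a j

/-- Apply the moment functional to `X^k (X + (1 - X))^(n-k)`, expanded binomially. Since the
factorial ratio is close to `(j/n)^k`, `a k` is nearly the `k`-th moment of the weights placed at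
the points `j/n`. -/
theorem moment_eq_sum_bernsteinWeight (a : ℕ → ℝ) {k n : ℕ} (hk : k ≤ n) :
    a k = ∑ j ∈ Finset.range (n + 1),
      bernsteinWeight a n j * (j.descFactorial k / n.descFactorial k) := by
  obtain ⟨m, rfl⟩ := Nat.exists_eq_add_of_le hk
  rw [add_assoc, Finset.sum_range_add]
  rw [Finset.sum_eq_zero (s := Finset.range k), zero_add]
  · have h : (Polynomial.X ^ k : Polynomial ℝ) = ∑ i ∈ Finset.range (m + 1),
        (m.choose i : ℝ) • (Polynomial.X ^ (k + i) * (1 - Polynomial.X) ^ (m - i)) := by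
      calc (Polynomial.X ^ k : Polynomial ℝ)
          = Polynomial.X ^ k * (Polynomial.X + (1 - Polynomial.X)) ^ m := by simp
        _ = _ := by
          rw [add_pow, Finset.mul_sum]
          refine Finset.sum_congr rfl fun i _ => ?_
          rw [Polynomial.smul_eq_C_mul, pow_add, Polynomial.C_eq_natCast]
          ring
    rw [← momentFunctional_X_pow a k, h, map_sum]
    refine Finset.sum_congr rfl fun i hi => ?_
    have hi' : i ≤ m := by simpa [Nat.lt_succ_iff] using hi
    rw [map_smul, momentFunctional_X_pow_mul, bernsteinWeight, smul_eq_mul,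
      show k + m - (k + i) = m - i by omega]
    have h1 := Nat.choose_mul (n := k + m) (k := k + i) (s := k) (by omega)
    rw [show k + m - k = m by omega, show k + i - k = i by omega] at h1
    have h2 : ((k + m).descFactorial k : ℝ) ≠ 0 := by
      have := Nat.descFactorial_pos.2 (show k ≤ k + m by omega)
      positivity
    have h3 : ((k + m).choose (k + i) * (k + i).descFactorial k : ℝ)
        = (k + m).descFactorial k * m.choose i := by
      rw [Nat.descFactorial_eq_factorial_mul_choose, Nat.descFactorial_eq_factorial_mul_choose]
      have h4 : ((k + m).choose (k + i) * (k + i).choose k : ℝ)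
        = (k + m).choose k * m.choose i := by exact_mod_cast h1
      push_cast
      linear_combination (k.factorial : ℝ) * h4
    field_simp
    linear_combination (-(negDiff^[m - i] a (k + i))) * h3
  · intro j hj
    rw [Nat.descFactorial_eq_zero_iff_lt.2 (Finset.mem_range.1 hj)]
    simp

theorem descFactorial_div_mem_Icc {n j : ℕ} (hj : j ≤ n) (k : ℕ) :
    (j.descFactorial k / n.descFactorial k : ℝ) ∈ Icc (0 : ℝ) 1 :=
  ⟨by positivity, div_le_one_of_le₀ (by exact_mod_cast Nat.descFactorial_le k hj) (by positivity)⟩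

/-- Raising `k` by one multiplies the two terms by `(j-k)/(n-k)` and `j/n`, which differ by at most
`k/n`. All factors lie in `[0, 1]`, so errors add, and `k + k² ≤ (k+1)²`. -/
theorem abs_descFactorial_div_sub_pow_le {n j k : ℕ} (hj : j ≤ n) (hk : k ≤ n) :
    |(j.descFactorial k / n.descFactorial k : ℝ) - (j / n) ^ k| ≤ k ^ 2 / n := by
  induction k with
  | zero => simp
  | succ k ih =>
    have hn : (0 : ℝ) < n := by
      have : 0 < n := by omega
      exact_mod_cast this
    have hkn : (0 : ℝ) < (n - k : ℕ) := by
      have : 0 < n - k := by omega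
      exact_mod_cast this
    have hstep : |((j - k : ℕ) / (n - k : ℕ) : ℝ) - j / n| ≤ k / n := by
      rcases le_total k j with h | h
      · have hjn : (j : ℝ) ≤ n := by exact_mod_cast hj
        have hkj : (k : ℝ) ≤ j := by exact_mod_cast h
        rw [Nat.cast_sub (by omega)] at hkn
        rw [Nat.cast_sub (by omega), Nat.cast_sub (by omega), abs_sub_comm, abs_of_nonneg]
        · rw [sub_le_iff_le_add, ← sub_nonneg]
          have : (k / n + (j - k) / (n - k) - j / n : ℝ) = k * (j - k) / (n * (n - k)) := by
            field_simp; ring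
          rw [this]
          have : (0:ℝ) ≤ j - k := by linarith
          positivity
        · have : (j / n - (j - k) / (n - k) : ℝ) = k * (n - j) / (n * (n - k)) := by
            field_simp; ring
          rw [this]
          have : (0:ℝ) ≤ n - j := by linarith
          positivity
      -- Truncated subtraction makes the new factor `0` here, and `j/n ≤ k/n`.
      · rw [Nat.sub_eq_zero_of_le h]
        simp only [CharP.cast_eq_zero, zero_div, zero_sub, abs_neg]
        rw [abs_of_nonneg (by positivity)]
        gcongr
    have hp := descFactorial_div_mem_Icc hj k
    have hq : ((j : ℝ) / n) ∈ Icc (0 : ℝ) 1 :=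
      ⟨by positivity, div_le_one_of_le₀ (by exact_mod_cast hj) (by positivity)⟩
    have ih' := ih (by omega)
    have hr : ((j - k : ℕ) / (n - k : ℕ) : ℝ) ∈ Icc (0 : ℝ) 1 :=
      ⟨by positivity, div_le_one_of_le₀ (by exact_mod_cast Nat.sub_le_sub_right hj k)
        (by positivity)⟩
    rw [Nat.descFactorial_succ, Nat.descFactorial_succ, Nat.cast_mul, Nat.cast_mul,
      mul_div_mul_comm, pow_succ]
    set p : ℝ := j.descFactorial k / n.descFactorial k
    set q : ℝ := (j : ℝ) / n
    set r : ℝ := (j - k : ℕ) / (n - k : ℕ)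
    calc |r * p - q ^ k * q| = |p * (r - q) + q * (p - q ^ k)| := by ring_nf
      _ ≤ |p * (r - q)| + |q * (p - q ^ k)| := abs_add_le _ _
      _ = p * |r - q| + q * |p - q ^ k| := by
        rw [abs_mul, abs_mul, abs_of_nonneg hp.1, abs_of_nonneg hq.1]
      _ ≤ 1 * (k / n) + 1 * (k ^ 2 / n) := by
        gcongr
        · exact hp.2
        · exact hq.2
      _ ≤ ((k + 1 : ℕ) : ℝ) ^ 2 / n := by
        rw [one_mul, one_mul, ← add_div]
        gcongr
        push_cast
        nlinarith [(Nat.cast_nonneg k : (0 : ℝ) ≤ k)]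

/-- The **Hausdorff moment theorem**: a completely monotone sequence is the sequence of moments of
a finite measure on the unit interval. -/
theorem exists_measure_moment_eq {a : ℕ → ℝ} (ha : ∀ n j, 0 ≤ negDiff^[n] a j) :
    ∃ μ : Measure I, IsFiniteMeasure μ ∧ ∀ k, ∫ u, (u : ℝ) ^ k ∂μ = a k := by
  have hw : ∀ n j, 0 ≤ bernsteinWeight a n j := fun n j =>
    mul_nonneg (Nat.cast_nonneg _) (ha _ _)
  let z : ℕ → ℕ → I := fun n j => projIcc 0 1 zero_le_one ((j : ℝ) / n)
  have hz : ∀ n j, j ≤ n → (z n j : ℝ) = j / n := by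
    intro n j hj
    simp only [z]
    rw [projIcc_of_mem]
    exact ⟨by positivity, div_le_one_of_le₀ (by exact_mod_cast hj) (by positivity)⟩
  let ν : ℕ → Measure I := fun n => ∑ j ∈ Finset.range (n + 1),
    (bernsteinWeight a n j).toNNReal • Measure.dirac (z n j)
  have hfin : ∀ n, IsFiniteMeasure (ν n) := fun n => by
    simp only [ν]; infer_instance
  have hint : ∀ n (g : C(I, ℝ)), ∫ u, g u ∂ν n =
      ∑ j ∈ Finset.range (n + 1), bernsteinWeight a n j * g (z n j) := by
    intro n g
    simp only [ν]
    rw [integral_finsetSum_measure]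
    · refine Finset.sum_congr rfl fun j _ => ?_
      rw [integral_smul_nnreal_measure, integral_dirac, NNReal.smul_def,
        Real.coe_toNNReal _ (hw n j), smul_eq_mul]
    · intro j _
      exact (map_continuous g).integrable_of_hasCompactSupport (HasCompactSupport.of_compactSpace _)
  have hsum : ∀ n, ∑ j ∈ Finset.range (n + 1), bernsteinWeight a n j = a 0 := by
    intro n
    simpa using (moment_eq_sum_bernsteinWeight a (Nat.zero_le n)).symm
  have hmass : ∀ n, (ν n).real univ = a 0 := by
    intro n
    have := hint n (ContinuousMap.const I 1)
    simpa [hsum] using this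
  obtain ⟨μ, hμ, hlim⟩ := exists_finiteMeasure_tendsto_ultrafilter (hyperfilter ℕ) ν hmass
  refine ⟨μ, hμ, fun k => ?_⟩
  have h1 := hlim ⟨fun u => (u : ℝ) ^ k, by fun_prop⟩
  refine tendsto_nhds_unique h1 ?_
  refine Tendsto.mono_left ?_ Nat.hyperfilter_le_atTop
  have hk : ∀ n, ∫ u, (u : ℝ) ^ k ∂ν n =
      ∑ j ∈ Finset.range (n + 1), bernsteinWeight a n j * (z n j : ℝ) ^ k :=
    fun n => hint n ⟨fun u => (u : ℝ) ^ k, by fun_prop⟩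
  simp only [ContinuousMap.coe_mk, hk]
  rw [tendsto_iff_norm_sub_tendsto_zero]
  refine squeeze_zero' (g := fun n : ℕ => a 0 * (k ^ 2 / (n : ℝ)))
    (Eventually.of_forall fun _ => norm_nonneg _) ?_ ?_
  · filter_upwards [eventually_ge_atTop k] with n hn
    rw [← hsum n, Finset.sum_mul]
    conv_lhs => rw [moment_eq_sum_bernsteinWeight a hn]
    rw [← Finset.sum_sub_distrib]
    refine (norm_sum_le _ _).trans (Finset.sum_le_sum fun j hj => ?_)
    have hj' : j ≤ n := by simpa [Nat.lt_succ_iff] using hj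
    rw [← mul_sub, norm_mul, Real.norm_of_nonneg (hw n j), hz n j hj', norm_sub_rev]
    exact mul_le_mul_of_nonneg_left (abs_descFactorial_div_sub_pow_le hj' hn) (hw n j)
  · simpa using (tendsto_const_div_atTop_nhds_zero_nat ((k : ℝ) ^ 2)).const_mul (a 0)

/-! ### Bernstein's theorem -/

namespace CompletelyMonotoneOn

variable {f : ℝ → ℝ} {a : ℝ}

theorem apply_nonneg (hf : CompletelyMonotoneOn f (Ici a)) {x : ℝ} (hx : x ∈ Ici a) : 0 ≤ f x := by
  have h : ∀ y ∈ Ioi a, 0 ≤ f y := fun y hy => by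
    simpa using hf.nonneg 0 y (by rwa [interior_Ici])
  have hsub : Ici a ⊆ closure (Ioi a) := by rw [closure_Ioi]
  have hc : ContinuousWithinAt f (Ioi a) x := (hf.continuousOn x hx).mono Ioi_subset_Ici_self
  have : (𝓝[Ioi a] x).NeBot := mem_closure_iff_nhdsWithin_neBot.1 (hsub hx)
  exact ge_of_tendsto hc (eventually_nhdsWithin_of_forall h)

theorem hasDerivAt_iteratedDeriv (hf : CompletelyMonotoneOn f (Ici a)) (n : ℕ) {x : ℝ}
    (hx : a < x) : HasDerivAt (iteratedDeriv n f) (iteratedDeriv (n + 1) f x) x := by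
  have hs : IsOpen (Ioi a) := isOpen_Ioi
  have hcd := hf.contDiffOn
  rw [interior_Ici] at hcd
  have h1 := hcd.differentiableOn_iteratedDerivWithin (m := n) (by exact_mod_cast ENat.natCast_lt_top n)
    hs.uniqueDiffOn
  have h2 : DifferentiableOn ℝ (iteratedDeriv n f) (Ioi a) :=
    h1.congr fun y hy => (iteratedDerivWithin_of_isOpen hs hy).symm
  rw [iteratedDeriv_succ]
  exact (h2.differentiableAt (hs.mem_nhds hx)).hasDerivAt

theorem iteratedDeriv_add_le (hf : CompletelyMonotoneOn f (Ici a)) (n : ℕ) {x h : ℝ}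
    (hx : a < x) (hh : 0 ≤ h) :
    (-1) ^ n * iteratedDeriv n f (x + h) ≤ (-1) ^ n * iteratedDeriv n f x := by
  have hd : ∀ y ∈ Ioi a, HasDerivAt (fun y => (-1) ^ n * iteratedDeriv n f y)
      ((-1) ^ n * iteratedDeriv (n + 1) f y) y := fun y hy =>
    (hf.hasDerivAt_iteratedDeriv n hy).const_mul _
  have : AntitoneOn (fun y => (-1) ^ n * iteratedDeriv n f y) (Ioi a) := by
    refine antitoneOn_of_deriv_nonpos (convex_Ioi a)
      (fun y hy => (hd y hy).continuousAt.continuousWithinAt) ?_ ?_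
    · rw [interior_Ioi]
      exact fun y hy => (hd y hy).differentiableAt.differentiableWithinAt
    · rw [interior_Ioi]
      intro y hy
      rw [(hd y hy).deriv]
      have := hf.nonneg (n + 1) y (by rwa [interior_Ici])
      rw [pow_succ] at this
      linarith
  exact this hx (show a < x + h by linarith) (by linarith)

/-- The signed derivatives are nonincreasing, so the class is stable under differences; iterating
turns the sign condition on derivatives into Hausdorff's condition on differences. -/
theorem sub_comp_add (hf : CompletelyMonotoneOn f (Ici a)) {h : ℝ} (hh : 0 ≤ h) :
    CompletelyMonotoneOn (fun x => f x - f (x + h)) (Ici a) := by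
  have hmaps : MapsTo (fun x => x + h) (Ici a) (Ici a) := fun x (hx : a ≤ x) =>
    show a ≤ x + h by linarith
  have hmaps' : MapsTo (fun x => x + h) (Ioi a) (Ioi a) := fun x (hx : a < x) =>
    show a < x + h by linarith
  have hcd := hf.contDiffOn
  rw [interior_Ici] at hcd
  have hcd' : ContDiffOn ℝ ∞ (fun x => f (x + h)) (Ioi a) := hcd.comp (by fun_prop) hmaps'
  refine ⟨hf.continuousOn.sub (hf.continuousOn.comp (by fun_prop) hmaps), ?_, ?_⟩
  · rw [interior_Ici]
    exact hcd.sub hcd'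
  · rw [interior_Ici]
    intro n x hx
    have hn : (n : WithTop ℕ∞) ≤ ∞ := by exact_mod_cast le_top
    have h1 := ((hcd.contDiffAt (isOpen_Ioi.mem_nhds hx)).of_le hn)
    have h2 := ((hcd'.contDiffAt (isOpen_Ioi.mem_nhds hx)).of_le hn)
    have h3 : iteratedDeriv n (fun x => f x - f (x + h)) x
        = iteratedDeriv n f x - iteratedDeriv n f (x + h) := by
      have := iteratedDeriv_sub h1 h2
      rw [iteratedDeriv_comp_add_const] at this
      exact this
    rw [h3, mul_sub, sub_nonneg]
    exact hf.iteratedDeriv_add_le n hx hh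

theorem negDiff_iterate_nonneg {h : ℝ} (hh : 0 ≤ h) (n : ℕ) :
    ∀ {f : ℝ → ℝ}, CompletelyMonotoneOn f (Ici a) →
      ∀ j, 0 ≤ negDiff^[n] (fun k : ℕ => f (a + k * h)) j := by
  induction n with
  | zero =>
    intro f hf j
    exact hf.apply_nonneg (show a ≤ a + j * h by have : 0 ≤ j * h := by positivity
                                                 linarith)
  | succ n ih =>
    intro f hf j
    have := ih (hf.sub_comp_add hh) j
    rw [Function.iterate_succ_apply]
    convert this using 3
    simp only [negDiff]
    push_cast
    ring_nf

theorem exists_measure_dyadic (hf : CompletelyMonotoneOn f (Ici a)) :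
    ∃ μ : Measure I, IsFiniteMeasure μ ∧
      ∀ k m : ℕ, ∫ u, (u : ℝ) ^ ((k : ℝ) / 2 ^ m) ∂μ = f (a + k / 2 ^ m) := by
  have hmom : ∀ m : ℕ, ∃ μ : Measure I, IsFiniteMeasure μ ∧
      ∀ k : ℕ, ∫ u, (u : ℝ) ^ ((k : ℝ) / 2 ^ m) ∂μ = f (a + k / 2 ^ m) := by
    intro m
    obtain ⟨μ, hμ, h⟩ := exists_measure_moment_eq
      (fun n => hf.negDiff_iterate_nonneg (h := 1 / 2 ^ m) (by positivity) n)
    have hcont : Continuous (fun u : I => u ^ (2 ^ m)) := by fun_prop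
    -- This change of variable normalises all levels to the same exponents, so that they can be
    -- compared.
    refine ⟨μ.map (fun u : I => u ^ (2 ^ m)), inferInstance, fun k => ?_⟩
    have hg : Continuous (fun u : I => (u : ℝ) ^ ((k : ℝ) / 2 ^ m)) :=
      continuous_subtype_val.rpow_const fun _ => Or.inr (by positivity)
    rw [integral_map hcont.aemeasurable hg.aestronglyMeasurable]
    have := h k
    rw [mul_one_div] at this
    rw [← this]
    refine integral_congr_ae (Eventually.of_forall fun u => ?_)
    have hu : (0 : ℝ) ≤ u := u.2.1
    change ((u : ℝ) ^ (2 ^ m)) ^ ((k : ℝ) / 2 ^ m) = (u : ℝ) ^ k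
    rw [← Real.rpow_natCast (u : ℝ) (2 ^ m), ← Real.rpow_mul hu]
    push_cast
    rw [mul_div_cancel₀ _ (by positivity), Real.rpow_natCast]
  choose ν hν hνint using hmom
  have hmass : ∀ m, (ν m).real univ = f a := by
    intro m
    simpa using hνint m 0
  obtain ⟨μ, hμ, hlim⟩ := exists_finiteMeasure_tendsto_ultrafilter (hyperfilter ℕ) ν hmass
  refine ⟨μ, hμ, fun k m => ?_⟩
  have hg : Continuous (fun u : I => (u : ℝ) ^ ((k : ℝ) / 2 ^ m)) :=
    continuous_subtype_val.rpow_const fun _ => Or.inr (by positivity)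
  refine tendsto_nhds_unique (hlim ⟨_, hg⟩) (Tendsto.congr' ?_ tendsto_const_nhds)
  refine Nat.hyperfilter_le_atTop ?_
  filter_upwards [eventually_ge_atTop m] with n hn
  -- Level `n ≥ m` contains the grid of level `m`, so the sequence is eventually constant.
  have h := hνint n (k * 2 ^ (n - m))
  have he : ((k * 2 ^ (n - m) : ℕ) : ℝ) / 2 ^ n = k / 2 ^ m := by
    obtain ⟨d, rfl⟩ := Nat.exists_eq_add_of_le hn
    rw [Nat.add_sub_cancel_left]
    push_cast
    field_simp
    ring
  rw [he] at h
  exact h.symm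

theorem exists_measure_unitInterval (hf : CompletelyMonotoneOn f (Ici a)) :
    ∃ μ : Measure I, IsFiniteMeasure μ ∧ μ {0} = 0 ∧
      ∀ x : ℝ, 0 ≤ x → f (a + x) = ∫ u, (u : ℝ) ^ x ∂μ := by
  obtain ⟨μ, hμ, h⟩ := hf.exists_measure_dyadic
  refine ⟨μ.restrict {0}ᶜ, inferInstance, by simp, fun x hx => ?_⟩
  -- Dyadic approximation from the right. The `+ 1` keeps `d n > 0` even for `x = 0`, so that `0 ^ d
  -- n = 0` and the atom at `0` can be dropped; continuity of `f` then recovers the value at `a`.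
  let d : ℕ → ℝ := fun n => ((⌈x * 2 ^ n⌉₊ + 1 : ℕ) : ℝ) / 2 ^ n
  have hd0 : ∀ n, 0 < d n := fun n => by positivity
  have hpow : Tendsto (fun n : ℕ => (2 : ℝ) ^ n) atTop atTop :=
    tendsto_pow_atTop_atTop_of_one_lt one_lt_two
  have hd : Tendsto d atTop (𝓝 x) := by
    have h1 := ((tendsto_nat_ceil_mul_div_atTop hx).comp hpow).add
      (tendsto_inv_atTop_zero.comp hpow)
    rw [add_zero] at h1
    refine h1.congr fun n => ?_
    simp only [Function.comp, d]
    push_cast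
    rw [add_div, one_div]
  have hright : Tendsto (fun n => f (a + d n)) atTop (𝓝 (f (a + x))) := by
    have hw := hf.continuousOn (a + x) (show a ≤ a + x by linarith)
    refine hw.tendsto.comp (tendsto_nhdsWithin_iff.2 ⟨hd.const_add a, ?_⟩)
    exact Eventually.of_forall fun n => show a ≤ a + d n by linarith [hd0 n]
  have hval : ∀ n, f (a + d n) = ∫ u in {0}ᶜ, ((u : I) : ℝ) ^ d n ∂μ := by
    intro n
    rw [setIntegral_eq_integral_of_forall_compl_eq_zero]
    · exact (h _ n).symm
    · intro u hu
      have : u = 0 := by simpa using hu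
      rw [this]
      simp [Real.zero_rpow (hd0 n).ne']
  refine tendsto_nhds_unique hright ?_
  simp only [hval]
  refine tendsto_integral_of_dominated_convergence (fun _ => (1 : ℝ)) ?_ (integrable_const _) ?_ ?_
  · intro n
    exact (continuous_subtype_val.rpow_const
      fun _ => Or.inr (hd0 n).le).aestronglyMeasurable
  · intro n
    refine Eventually.of_forall fun u => ?_
    rw [Real.norm_of_nonneg (Real.rpow_nonneg u.2.1 _)]
    exact Real.rpow_le_one u.2.1 u.2.2 (hd0 n).le
  · filter_upwards [ae_restrict_mem (measurableSet_singleton (0 : I)).compl] with u hu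
    have hu' : (u : ℝ) ≠ 0 := fun h0 => hu (Subtype.ext h0)
    exact ((Real.continuousAt_const_rpow hu').tendsto).comp hd

/-- **Bernstein's theorem**: a completely monotone function on `[a, ∞)` is a mixture of decreasing
exponentials. -/
theorem exists_measure_eq_integral_exp (hf : CompletelyMonotoneOn f (Ici a)) :
    ∃ μ : Measure ℝ, IsFiniteMeasure μ ∧ μ (Ioi 0) = 0 ∧
      ∀ x ∈ Ici a, f x = ∫ t, Real.exp ((x - a) * t) ∂μ := by
  obtain ⟨μ, hμ, h0, h⟩ := hf.exists_measure_unitInterval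
  have hlog : Measurable (fun u : I => Real.log u) :=
    Real.measurable_log.comp measurable_subtype_coe
  -- The default `Real.log 0 = 0` is harmless because `μ {0} = 0`.
  refine ⟨μ.map (fun u : I => Real.log u), inferInstance, ?_, fun x (hx : a ≤ x) => ?_⟩
  · rw [Measure.map_apply hlog measurableSet_Ioi]
    convert measure_empty (μ := μ)
    ext u
    simpa using Real.log_nonpos u.2.1 u.2.2
  · rw [integral_map hlog.aemeasurable (by fun_prop), ← add_sub_cancel a x, h _ (by linarith)]
    refine integral_congr_ae ?_
    have : ∀ᵐ u ∂μ, u ≠ 0 := by simpa [ae_iff] using h0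
    filter_upwards [this] with u hu
    have hu' : (0 : ℝ) < u := lt_of_le_of_ne u.2.1 fun h => hu (Subtype.ext h.symm)
    rw [Real.rpow_def_of_pos hu', add_sub_cancel_left, mul_comm]

end CompletelyMonotoneOn

end UnitInterval

/-! ### Finiteness of consumer surplus and its behaviour near zero -/

namespace IsUtility

variable {U : ℝ → ℝ} {qbar : ℝ}

theorem intervalIntegrable (hU : IsUtility U qbar) {q : ℝ} (hq : q ∈ Ioc 0 qbar) :
    IntervalIntegrable (inverseDemand U qbar) volume q qbar := by
  refine (hU.antitoneOn.mono ?_).intervalIntegrable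
  rw [uIcc_of_le hq.2]
  exact fun x hx => ⟨hq.1.trans_le hx.1, hx.2⟩

theorem integral_inverseDemand (hU : IsUtility U qbar) {q : ℝ} (hq : q ∈ Ioc 0 qbar) :
    ∫ x in q..qbar, inverseDemand U qbar x = U qbar - U q := by
  refine intervalIntegral.integral_eq_sub_of_hasDerivAt_of_le hq.2
    (hU.differentiableOn.continuousOn.mono fun x hx => ⟨hq.1.trans_le hx.1, hx.2⟩)
    (fun x hx => ?_) (hU.intervalIntegrable hq)
  have hx' : x ∈ Ioc 0 qbar := ⟨hq.1.trans hx.1, hx.2.le⟩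
  exact (hU.differentiableOn x hx').hasDerivWithinAt.hasDerivAt
    (Ioc_mem_nhds hx'.1 hx.2)

theorem inverseDemand_ge (hU : IsUtility U qbar) {q : ℝ} (hq : q ∈ Ioc 0 qbar) :
    inverseDemand U qbar qbar ≤ inverseDemand U qbar q :=
  hU.antitoneOn hq ⟨hq.1.trans_le hq.2, le_rfl⟩ hq.2

/-- `P - P(qbar)` is nonnegative and its integrals over `(q, qbar]` are bounded through the lower
bound on `U`, hence it is integrable down to `0`. -/
theorem finiteConsumerSurplus (hU : IsUtility U qbar) (hqbar : 0 < qbar)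
    (hb : BddBelow (U '' Ioc 0 qbar)) : FiniteConsumerSurplus U qbar := by
  obtain ⟨B, hB⟩ := hb
  set P := inverseDemand U qbar with hP
  have hint : ∀ q ∈ Ioc 0 qbar, IntegrableOn (fun x => P x - P qbar) (Ioc q qbar) := fun q hq =>
    ((intervalIntegrable_iff_integrableOn_Ioc_of_le hq.2).1 (hU.intervalIntegrable hq)).sub
      (integrableOn_const (by simp))
  have hmain : IntegrableOn (fun x => P x - P qbar) (Ioc 0 qbar) := by
    let e : ℕ → ℝ := fun n => qbar / (n + 1)
    have he : ∀ n, e n ∈ Ioc 0 qbar := fun n => by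
      refine ⟨by positivity, div_le_self hqbar.le ?_⟩
      linarith [(Nat.cast_nonneg n : (0 : ℝ) ≤ n)]
    have hlim : Tendsto e atTop (𝓝 0) := by
      have := (tendsto_one_div_add_atTop_nhds_zero_nat (𝕜 := ℝ)).const_mul qbar
      simpa [e, div_eq_mul_inv] using this
    refine integrableOn_Ioc_of_intervalIntegral_norm_bounded_left
      (I := U qbar - B + qbar * |P qbar|) (fun n => hint _ (he n)) hlim
      (Eventually.of_forall fun n => ?_)
    have h1 : ∫ x in Ioc (e n) qbar, ‖P x - P qbar‖ = ∫ x in Ioc (e n) qbar, (P x - P qbar) := by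
      refine setIntegral_congr_fun measurableSet_Ioc fun x hx => ?_
      exact Real.norm_of_nonneg
        (sub_nonneg.2 (hU.inverseDemand_ge ⟨(he n).1.trans hx.1, hx.2⟩))
    rw [h1, ← intervalIntegral.integral_of_le (he n).2,
      intervalIntegral.integral_sub (hU.intervalIntegrable (he n)) (by simp),
      hU.integral_inverseDemand (he n), intervalIntegral.integral_const, smul_eq_mul]
    have h2 := hB (mem_image_of_mem U (he n))
    have h3 : -((qbar - e n) * P qbar) ≤ qbar * |P qbar| := by
      have h4 := (he n).1
      have h5 : 0 ≤ qbar - e n := sub_nonneg.2 (he n).2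
      calc -((qbar - e n) * P qbar) = (qbar - e n) * (-P qbar) := by ring
        _ ≤ (qbar - e n) * |P qbar| := by gcongr; exact neg_le_abs _
        _ ≤ qbar * |P qbar| := by gcongr; linarith
    linarith
  refine (intervalIntegrable_iff_integrableOn_Ioc_of_le hqbar.le).2 ?_
  have := hmain.add (integrableOn_const (C := P qbar) (by simp) : IntegrableOn _ (Ioc 0 qbar) volume)
  exact this.congr (Eventually.of_forall fun x => by simp [hP])

theorem bddBelow (hU : IsUtility U qbar) (hfin : FiniteConsumerSurplus U qbar) :
    BddBelow (U '' Ioc 0 qbar) := by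
  refine ⟨U qbar - ∫ x in Ioc 0 qbar, ‖inverseDemand U qbar x‖, ?_⟩
  rintro _ ⟨q, hq, rfl⟩
  have hqbar : 0 ≤ qbar := hq.1.le.trans hq.2
  have hi := ((intervalIntegrable_iff_integrableOn_Ioc_of_le hqbar).1 hfin).norm
  have h1 := hU.integral_inverseDemand hq
  have h2 : ∫ x in q..qbar, inverseDemand U qbar x ≤ ∫ x in Ioc 0 qbar, ‖inverseDemand U qbar x‖ :=
    calc ∫ x in q..qbar, inverseDemand U qbar x
        ≤ ‖∫ x in Ioc q qbar, inverseDemand U qbar x‖ := by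
          rw [intervalIntegral.integral_of_le hq.2]; exact Real.le_norm_self _
      _ ≤ ∫ x in Ioc q qbar, ‖inverseDemand U qbar x‖ := norm_integral_le_integral_norm _
      _ ≤ _ := setIntegral_mono_set hi (Eventually.of_forall fun _ => norm_nonneg _)
          (Ioc_subset_Ioc_left hq.1.le).eventuallyLE
  linarith

theorem consumerSurplus_le (hU : IsUtility U qbar) {q : ℝ} (hq : q ∈ Ioc 0 qbar) :
    consumerSurplus U qbar q ≤
      -(q * inverseDemand U qbar qbar) + ∫ x in (0 : ℝ)..q, inverseDemand U qbar x := by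
  have := mul_le_mul_of_nonneg_left (hU.inverseDemand_ge hq) hq.1.le
  unfold consumerSurplus
  linarith

theorem le_zero_of_forall_le_consumerSurplus (hU : IsUtility U qbar) (hqbar : 0 < qbar)
    (hfin : FiniteConsumerSurplus U qbar) {c : ℝ}
    (hc : ∀ q ∈ Ioc 0 qbar, c ≤ consumerSurplus U qbar q) : c ≤ 0 := by
  have hprim : ContinuousOn (fun q => ∫ x in (0 : ℝ)..q, inverseDemand U qbar x) (uIcc 0 qbar) :=
    intervalIntegral.continuousOn_primitive_interval (by
      rw [uIcc_of_le hqbar.le, integrableOn_Icc_iff_integrableOn_Ioc]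
      exact (intervalIntegrable_iff_integrableOn_Ioc_of_le hqbar.le).1 hfin)
  rw [uIcc_of_le hqbar.le] at hprim
  have h0 : ContinuousWithinAt (fun q => -(q * inverseDemand U qbar qbar) +
      ∫ x in (0 : ℝ)..q, inverseDemand U qbar x) (Ioc 0 qbar) 0 :=
    (ContinuousWithinAt.add (by fun_prop) (hprim 0 ⟨le_rfl, hqbar.le⟩)).mono Ioc_subset_Icc_self
  have : (𝓝[Ioc 0 qbar] (0 : ℝ)).NeBot := by
    rw [nhdsWithin_Ioc_eq_nhdsGT hqbar]; infer_instance
  have h1 := ge_of_tendsto h0.tendsto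
    (eventually_nhdsWithin_of_forall fun q hq => (hc q hq).trans (hU.consumerSurplus_le hq))
  simpa using h1

end IsUtility

/-! ### The two directions of the equivalence -/

/-- The Laplace transform of a nonnegative measure on `(-∞, 0)` is completely monotone. -/
theorem completelyMonotoneOn_of_eq_integral_exp {f : ℝ → ℝ} {a : ℝ} {ν : Measure ℝ}
    (hν : ∀ᵐ t ∂ν, t ≤ 0) (hint : Integrable (fun t => Real.exp (a * t)) ν)
    (hf : ∀ x ∈ Ici a, f x = ∫ t, Real.exp (x * t) ∂ν) : CompletelyMonotoneOn f (Ici a) := by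
  have hle : ∀ x ∈ Ici a, ∀ᵐ t ∂ν, ‖Real.exp (x * t)‖ ≤ Real.exp (a * t) := by
    intro x hx
    filter_upwards [hν] with t ht
    rw [Real.norm_of_nonneg (Real.exp_pos _).le]
    exact Real.exp_le_exp.2 (mul_le_mul_of_nonpos_right hx ht)
  have hset : Ici a ⊆ ProbabilityTheory.integrableExpSet id ν := fun x hx =>
    hint.mono' (by fun_prop) (hle x hx)
  have hset' : Ioi a ⊆ interior (ProbabilityTheory.integrableExpSet id ν) := by
    rw [← interior_Ici]; exact interior_mono hset
  have heq : EqOn f (ProbabilityTheory.mgf id ν) (Ici a) := fun x hx => hf x hx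
  refine ⟨?_, ?_, ?_⟩
  · refine ContinuousOn.congr (f := fun x => ∫ t, Real.exp (x * t) ∂ν) (fun x hx => ?_) hf
    -- Analyticity of the moment generating function covers only `x > a`; domination by the
    -- integrand at `a` gives continuity up to the endpoint.
    refine continuousWithinAt_of_dominated (bound := fun t => Real.exp (a * t))
      (Eventually.of_forall fun _ => by fun_prop) (eventually_nhdsWithin_of_forall hle) hint
      (Eventually.of_forall fun t => by fun_prop)
  · rw [interior_Ici]
    have h1 := (ProbabilityTheory.analyticOnNhd_mgf (X := id) (μ := ν)).mono hset'
    exact h1.contDiffOn (uniqueDiffOn_Ioi a) |>.congr (heq.mono Ioi_subset_Ici_self)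
  · rw [interior_Ici]
    intro n x hx
    have h1 : f =ᶠ[𝓝 x] ProbabilityTheory.mgf id ν := by
      filter_upwards [isOpen_Ioi.mem_nhds hx] with y hy using heq (Ioi_subset_Ici_self hy)
    rw [h1.iteratedDeriv_eq, ProbabilityTheory.iteratedDeriv_mgf (hset' hx),
      ← integral_const_mul]
    refine integral_nonneg_of_ae ?_
    filter_upwards [hν] with t ht
    simp only [id, ← mul_assoc, ← mul_pow, Pi.zero_apply]
    have : 0 ≤ -1 * t := by linarith
    positivity

theorem neg_log_mem_Ici {q qbar : ℝ} (hq : q ∈ Ioc 0 qbar) : -Real.log q ∈ Ici (-Real.log qbar) :=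
  neg_le_neg (Real.log_le_log hq.1 hq.2)

theorem exists_isNonnegLaplaceConsumerSurplus {U : ℝ → ℝ} {qbar : ℝ} (hqbar : 0 < qbar)
    (hU : IsUtility U qbar) (hb : BddBelow (U '' Ioc 0 qbar))
    (hcm : CompleteMonotonicityCriterion U qbar) :
    ∃ cs : Measure ℝ, IsNonnegLaplaceConsumerSurplus U qbar cs := by
  have hfin := hU.finiteConsumerSurplus hqbar hb
  obtain ⟨μ, hμ, hpos, h⟩ := CompletelyMonotoneOn.exists_measure_eq_integral_exp hcm
  have hae : ∀ᵐ t ∂μ, t ≤ 0 := by simpa [ae_iff, Ioi] using hpos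
  have hCS : ∀ q ∈ Ioc 0 qbar, consumerSurplus U qbar q =
      ∫ t, Real.exp ((Real.log qbar - Real.log q) * t) ∂μ := by
    intro q hq
    have := h _ (neg_log_mem_Ici hq)
    rw [neg_neg, Real.exp_log hq.1] at this
    rw [this]
    ring_nf
  have hint : ∀ q ∈ Ioc 0 qbar,
      Integrable (fun t => Real.exp ((Real.log qbar - Real.log q) * t)) μ := by
    intro q hq
    refine (integrable_const (1 : ℝ)).mono' (by fun_prop) ?_
    filter_upwards [hae] with t ht
    rw [Real.norm_of_nonneg (Real.exp_pos _).le]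
    exact Real.exp_le_one_iff.2
      (mul_nonpos_of_nonneg_of_nonpos (sub_nonneg.2 (Real.log_le_log hq.1 hq.2)) ht)
  -- An atom at `t = 0` contributes a constant to `CS`, hence bounds it below for every `q`.
  have hatom : μ {0} = 0 := by
    have hle : μ.real {0} ≤ 0 := by
      refine hU.le_zero_of_forall_le_consumerSurplus hqbar hfin fun q hq => ?_
      rw [hCS q hq]
      have := setIntegral_le_integral (s := {0}) (hint q hq)
        (Eventually.of_forall fun _ => (Real.exp_pos _).le)
      simpa [integral_singleton, Measure.real] using this
    exact (measureReal_eq_zero_iff).1 (le_antisymm hle measureReal_nonneg)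
  have hnull : μ (Ici 0) = 0 := by
    rw [← Ioi_insert, insert_eq]
    exact measure_union_null hatom hpos
  -- Bernstein's measure represents `CS` by `(qbar/q)^t`; the density `qbar^t` turns this into
  -- `q^{-t}`. It is unbounded on `t < 0` when `qbar < 1`, so `cs` may be infinite.
  let w : ℝ → ENNReal := fun t => ENNReal.ofReal (Real.exp (Real.log qbar * t))
  have hw : Measurable w := by fun_prop
  have hwfin : ∀ᵐ t ∂μ, w t < ⊤ := Eventually.of_forall fun t => ENNReal.ofReal_lt_top
  have hsmul : ∀ q ∈ Ioc 0 qbar, (fun t => (w t).toReal • q ^ (-t)) =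
      fun t => Real.exp ((Real.log qbar - Real.log q) * t) := by
    intro q hq
    funext t
    rw [ENNReal.toReal_ofReal (Real.exp_pos _).le, Real.rpow_def_of_pos hq.1, smul_eq_mul,
      ← Real.exp_add]
    ring_nf
  have hnull' : μ.withDensity w (Ici 0) = 0 := withDensity_absolutelyContinuous μ w hnull
  have hrestrict : (μ.withDensity w).restrict (Iio 0) = μ.withDensity w :=
    Measure.restrict_eq_self_of_ae_mem (by simpa [ae_iff, Ici] using hnull')
  refine ⟨μ.withDensity w, hfin, hnull', fun q hq => ?_, fun q hq => ?_⟩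
  · rw [IntegrableOn, hrestrict, integrable_withDensity_iff_integrable_smul' hw hwfin,
      hsmul q hq]
    exact hint q hq
  · rw [hrestrict, integral_withDensity_eq_integral_toReal_smul hw hwfin, hsmul q hq]
    exact hCS q hq

theorem IsNonnegLaplaceConsumerSurplus.completeMonotonicityCriterion {U : ℝ → ℝ} {qbar : ℝ}
    {cs : Measure ℝ} (hcs : IsNonnegLaplaceConsumerSurplus U qbar cs) (hqbar : 0 < qbar) :
    CompleteMonotonicityCriterion U qbar := by
  have hrpow : ∀ x t : ℝ, Real.exp (-x) ^ (-t) = Real.exp (x * t) := fun x t => by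
    rw [← Real.exp_mul, neg_mul_neg]
  have hmem : ∀ x ∈ Ici (-Real.log qbar), Real.exp (-x) ∈ Ioc 0 qbar := fun x hx =>
    ⟨Real.exp_pos _, by
      rw [← Real.le_log_iff_exp_le hqbar]
      exact neg_le.1 hx⟩
  refine completelyMonotoneOn_of_eq_integral_exp (ν := cs.restrict (Iio 0)) ?_ ?_ fun x hx => ?_
  · filter_upwards [ae_restrict_mem measurableSet_Iio] with t ht using le_of_lt ht
  · have := hcs.integrableOn _ (hmem _ self_mem_Ici)
    simpa only [hrpow, IntegrableOn] using this
  · have := hcs.eq_integral _ (hmem x hx)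
    simpa only [hrpow] using this

theorem theorem7 (U : ℝ → ℝ) (qbar : ℝ) (hqbar : 0 < qbar) (hU : IsUtility U qbar) :
    (BddBelow (U '' Ioc 0 qbar) ∧ CompleteMonotonicityCriterion U qbar) ↔
      ∃ cs : Measure ℝ, IsNonnegLaplaceConsumerSurplus U qbar cs :=
  ⟨fun h => exists_isNonnegLaplaceConsumerSurplus hqbar hU h.1 h.2, fun ⟨_, hcs⟩ =>
    ⟨hU.bddBelow hcs.finite, hcs.completeMonotonicityCriterion hqbar⟩⟩
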